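/- Let $L$ be a real Fréchet space, i.e. a locally convex topological vector space over $\mathbb R$ endowed with a complete translation-invariant metric $d$ that generates its topology. Let $C\subset L$ be a convex cone, i.e. a convex set with $\mathbb R_+\cdot C=C$, where $\mathbb R_+=[0,\infty)$. If $C$ is non-separable, then the metric space $(C,d)$ has the separated approximation property (SAP): for every $\varepsilon>0$ there is a sequence of continuous maps $f_n:C\to C$, $n\in\{0,1,2,\dots\}$, such that 1. each $f_n$ is $\varepsilon$-homotopic to the identity of $C$, i.e. there is a homotopy $(h_t)_{t\in[0,1]}:C\to C$ with $h_0=f_n$, $h_1=\mathrm{id}_C$ and $\operatorname{diam}\{h_t(x):t\in[0,1]\}\le\varepsilon$ for all $x\in C$; 2. the images are separated: $\inf_{n\ne m}d(f_n(C),f_m(C))>0$, where $d(A,B)=\inf\{d(a,b):a\in A,\ b\in B\}$. -/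

import Mathlib

open scoped unitInterval Pointwise ENNReal

/-- A convex cone: a convex set `C` with `ℝ₊ · C = C`, where `ℝ₊ = [0, ∞)`. -/
def IsConvexCone {L : Type*} [AddCommGroup L] [Module ℝ L] (C : Set L) : Prop :=
  Convex ℝ C ∧ Set.Ici (0 : ℝ) • C = C

/-- Two continuous maps `f, g : A → X` are `ε`-homotopic if they are linked by a homotopy
`(h_t)` with `h_0 = f`, `h_1 = g`, all of whose tracks `{h_t(a) : t ∈ [0,1]}` have diameter
at most `ε`. (The tracks are compact, so their real-valued diameter is the true one.) -/
def EpsHomotopic {A X : Type*} [TopologicalSpace A] [MetricSpace X] (ε : ℝ)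
    (f g : C(A, X)) : Prop :=
  ∃ h : ContinuousMap.Homotopy f g,
    ∀ a : A, Metric.diam (Set.range fun t : I => h (t, a)) ≤ ε

/-- The distance `d(A, B) = inf {d(a, b) : a ∈ A, b ∈ B}` between two sets, taken in `[0, ∞]`
(it is finite, and equals the real infimum, when `A` and `B` are non-empty). -/
noncomputable def setEDist {X : Type*} [MetricSpace X] (A B : Set X) : ℝ≥0∞ :=
  ⨅ a ∈ A, ⨅ b ∈ B, edist a b

/-- A sequence of sets is separated if `inf_{n ≠ m} d(A_n, A_m) > 0`. -/
def IsSeparatedSeq {X : Type*} [MetricSpace X] (A : ℕ → Set X) : Prop :=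
  0 < ⨅ (n : ℕ) (m : ℕ) (_ : n ≠ m), setEDist (A n) (A m)

/-- The separated approximation property (SAP) of a metric space: for each `ε > 0` there are
continuous maps `f_n : X → X`, each `ε`-homotopic to the identity, with separated images. -/
def HasSAP (X : Type*) [MetricSpace X] : Prop :=
  ∀ ε : ℝ, 0 < ε → ∃ f : ℕ → C(X, X),
    (∀ n, EpsHomotopic ε (f n) (ContinuousMap.id X)) ∧
      IsSeparatedSeq fun n => Set.range (f n)

/-!
The maps `f n` move each point of the cone a little, by adding a marker that depends on `n` and
that can be read off afterwards by linear functionals.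

Let `p` be a continuous seminorm whose unit ball is small, and `K = {x ∈ C | p x ≤ 1}`. Suppose
there are functionals `g k` with `|g k| ≤ p` that tend to `0` pointwise on `C`, and points `c k ∈ K`
with `g k (c k) ≥ δ > 0`, that is, `HasNullSeq p K` holds. The functionals `g e` with `e` beyond
some level of `x`, which can be chosen to depend continuously on `x`, are small at `x`.
Put `f n x = x + M n x`, where `M n x` lies on the `n`-th of countably many piecewise linear paths,
which use pairwise disjoint sets of vertices `c e`, at a time determined by the level of `x`.
For a suitable index `e`, the functional `g e` sees the marker in one of the points `f n x`
and `f m y` but nothing comparable in the other one, so the two points stay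
uniformly apart (`HasNullSeq.exists_markers`). As the markers belong to the cone and are small,
`f n` is joined to the identity by a homotopy along short segments.

It remains to find the `g k` and `c k`. If `C` is not separable, then `p` can be chosen such that
no finite-dimensional subspace is uniformly close to `K` (`exists_seminorm_forall_finite`), and the
Hahn-Banach theorem gives a bounded triangular system of functionals and points of `K`. Some
subsequence of the functionals converges on a countable set controlling their span. If
it also converges on `K`, its successive differences form the sequence looked for. If not,
one passes to convex combinations of differences (`hasNullSeq_of_triangular`), which
requires tail blocks converging pointwise on `K`. These exist unless some sequence has all its
tail blocks oscillating on `K` by a fixed amount (`exists_isTailBlock_cauchySeq_or_hasNullSeq`);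
in that case, repeatedly replacing a sequence by half sums and recording half differences produces
functionals that satisfy Bessel's inequality with respect to `p`, so that they tend to `0`
pointwise, but not uniformly on `K` (`hasNullSeq_of_gap`).
-/

open Filter Topology Set

/-! ### Tail blocks and null sequences -/

/-- `IsTailBlock z y`: for every `N`, all but finitely many terms of `z` are convex combinations
of the terms `y i` with `i ≥ N`. Subsequences and sequences of convex blocks of `y` are examples,
and finitely many terms of `z` are unrestricted. -/
def IsTailBlock {E : Type*} [AddCommGroup E] [Module ℝ E] (z y : ℕ → E) : Prop :=
  ∀ N, ∀ᶠ k in atTop, z k ∈ convexHull ℝ (y '' Ici N)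

/-- There is a sequence of linear functionals dominated by `p` that tends to `0` pointwise on `K`
but not uniformly: the `k`-th functional is at least `δ` at the point `c k` of `K`. -/
def HasNullSeq {L : Type*} [AddCommGroup L] [Module ℝ L] (p : Seminorm ℝ L) (K : Set L) : Prop :=
  ∃ (g : ℕ → L →ₗ[ℝ] ℝ) (c : ℕ → L) (δ : ℝ), 0 < δ ∧ (∀ k x, |g k x| ≤ p x) ∧
    (∀ k, c k ∈ K) ∧ (∀ x ∈ K, Tendsto (fun k => g k x) atTop (𝓝 0)) ∧ ∀ k, δ ≤ g k (c k)

section TailBlock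

variable {E : Type*} [AddCommGroup E] [Module ℝ E]

lemma IsTailBlock.refl (y : ℕ → E) : IsTailBlock y y := fun N => by
  filter_upwards [eventually_ge_atTop N] with k hk
  exact subset_convexHull ℝ _ ⟨k, hk, rfl⟩

lemma IsTailBlock.trans {x y z : ℕ → E} (hzy : IsTailBlock z y) (hyx : IsTailBlock y x) :
    IsTailBlock z x := fun N => by
  obtain ⟨M, hM⟩ := eventually_atTop.1 (hyx N)
  filter_upwards [hzy M] with k hk
  refine convexHull_min ?_ (convex_convexHull ℝ _) hk
  rintro _ ⟨i, hi, rfl⟩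
  exact hM i hi

/-- Averages of two terms, both arbitrarily far out, again form a tail block. -/
lemma IsTailBlock.average {a w : ℕ → E} (ha : IsTailBlock a w) {i j : ℕ → ℕ}
    (hi : ∀ N, N ≤ i N) (hj : ∀ N, N ≤ j N) :
    IsTailBlock (fun N => (1 / 2 : ℝ) • (a (i N) + a (j N))) w := fun N => by
  obtain ⟨M, hM⟩ := eventually_atTop.1 (ha N)
  filter_upwards [eventually_ge_atTop M] with k hk
  rw [smul_add]
  exact convex_convexHull ℝ _ (hM _ (hk.trans (hi k))) (hM _ (hk.trans (hj k)))
    (by norm_num) (by norm_num) (by norm_num)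

/-- Tail blocks of a sequence of iterated tail blocks can be diagonalised. -/
lemma IsTailBlock.exists_diagonal {Y : ℕ → ℕ → E} (hY : ∀ n, IsTailBlock (Y (n + 1)) (Y n)) :
    ∃ v : ℕ → E, ∀ n, IsTailBlock v (Y n) := by
  have hle : ∀ j d, IsTailBlock (Y (j + d)) (Y j) := by
    intro j d
    induction d with
    | zero => exact .refl _
    | succ d ih => exact (hY (j + d)).trans ih
  have hex : ∀ k, ∃ m, ∀ j ∈ Finset.range (k + 1), Y k m ∈ convexHull ℝ (Y j '' Ici k) := by
    intro k
    have : ∀ᶠ m in atTop, ∀ j ∈ Finset.range (k + 1), Y k m ∈ convexHull ℝ (Y j '' Ici k) := by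
      rw [Filter.eventually_all_finset]
      intro j hj
      obtain ⟨d, rfl⟩ := Nat.exists_eq_add_of_le (Finset.mem_range_succ_iff.1 hj)
      exact hle j d _
    exact this.exists
  choose m hm using hex
  refine ⟨fun k => Y k (m k), fun n N => ?_⟩
  filter_upwards [eventually_ge_atTop n, eventually_ge_atTop N] with k hk hN
  exact convexHull_mono (image_mono (Ici_subset_Ici.2 hN))
    (hm k n (Finset.mem_range_succ_iff.2 hk))

end TailBlock

/-! ### Convergent tail blocks or null sequences -/

section Dichotomy

variable {L : Type*} [AddCommGroup L] [Module ℝ L]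

/-- The functionals dominated by `p` form a convex set. -/
lemma convex_dominated (p : Seminorm ℝ L) :
    Convex ℝ {g : L →ₗ[ℝ] ℝ | ∀ x, |g x| ≤ p x} := by
  intro f hf g hg s t hs ht hst x
  have h1 := hf x
  have h2 := hg x
  rw [abs_le] at *
  simp only [LinearMap.add_apply, LinearMap.smul_apply, smul_eq_mul]
  have : p x = s * p x + t * p x := by rw [← add_mul, hst, one_mul]
  constructor <;> nlinarith

lemma IsTailBlock.exists_dominated {p : Seminorm ℝ L} {a w : ℕ → L →ₗ[ℝ] ℝ}
    (ha : IsTailBlock a w) (hw : ∀ k x, |w k x| ≤ p x) : ∀ᶠ k in atTop, ∀ x, |a k x| ≤ p x := by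
  filter_upwards [ha 0] with k hk
  refine convexHull_min ?_ (convex_dominated p) hk
  rintro _ ⟨i, -, rfl⟩
  exact hw i

/-- A convex combination of functionals whose values at `x` lie in a convex set `S` has its
value at `x` in `S`. -/
lemma apply_mem_of_mem_convexHull {A : Set (L →ₗ[ℝ] ℝ)} {g : L →ₗ[ℝ] ℝ} {x : L} {S : Set ℝ}
    (hS : Convex ℝ S) (hA : ∀ f ∈ A, f x ∈ S) (hg : g ∈ convexHull ℝ A) : g x ∈ S :=
  convexHull_min (t := (LinearMap.applyₗ x : (L →ₗ[ℝ] ℝ) →ₗ[ℝ] ℝ) ⁻¹' S) hA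
    (hS.linear_preimage _) hg

/-- A finite stage in the construction of a square-summable system of functionals: sequences
of functionals `a` and `φ l`, and points `x l`, for `l < M`, such that `a` and the `φ l` satisfy
Bessel's inequality with respect to `p`, while `φ l` stays large at `x l`. -/
structure BesselStage (p : Seminorm ℝ L) (K : Set L) (w : ℕ → L →ₗ[ℝ] ℝ) (ω : ℝ) (M : ℕ)
    (x : ℕ → L) (a : ℕ → L →ₗ[ℝ] ℝ) (φ : ℕ → ℕ → L →ₗ[ℝ] ℝ) : Prop where
  block : IsTailBlock a w
  mem : ∀ l < M, x l ∈ K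
  bessel : ∀ k v, a k v ^ 2 + ∑ l ∈ Finset.range M, φ l k v ^ 2 ≤ p v ^ 2
  large : ∀ l < M, ∀ k, ω / 2 ≤ φ l k (x l)

/-- If `a` oscillates by at least `ω` at a point, then half the differences of suitable terms
of `a` provide a further functional; half the sums replace `a`. Bessel's inequality is preserved by
the parallelogram law. -/
lemma BesselStage.exists_succ {p : Seminorm ℝ L} {K : Set L} {w : ℕ → L →ₗ[ℝ] ℝ} {ω : ℝ}
    (hgap : ∀ a, IsTailBlock a w → ∃ x ∈ K, ∀ N, ∃ i ≥ N, ∃ j ≥ N, ω ≤ a i x - a j x)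
    {M : ℕ} {x : ℕ → L} {a : ℕ → L →ₗ[ℝ] ℝ} {φ : ℕ → ℕ → L →ₗ[ℝ] ℝ}
    (h : BesselStage p K w ω M x a φ) :
    ∃ y a' φ', BesselStage p K w ω (M + 1) (Function.update x M y) a' φ' := by
  obtain ⟨y, hyK, hy⟩ := hgap a h.block
  choose i hi j hj hij using hy
  refine ⟨y, fun N => (1 / 2 : ℝ) • (a (i N) + a (j N)), fun l N =>
    if l = M then (1 / 2 : ℝ) • (a (i N) - a (j N)) else (1 / 2 : ℝ) • (φ l (i N) + φ l (j N)),
    h.block.average hi hj, ?_, ?_, ?_⟩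
  · intro l hl
    rcases eq_or_ne l M with rfl | hne
    · simpa using hyK
    · rw [Function.update_of_ne hne]
      exact h.mem l (by omega)
  · intro k v
    have h1 := h.bessel (i k) v
    have h2 := h.bessel (j k) v
    have h3 : ∑ l ∈ Finset.range M, ((1 / 2 : ℝ) * (φ l (i k) v + φ l (j k) v)) ^ 2 ≤
        1 / 2 * ∑ l ∈ Finset.range M, φ l (i k) v ^ 2 +
          1 / 2 * ∑ l ∈ Finset.range M, φ l (j k) v ^ 2 := by
      rw [Finset.mul_sum, Finset.mul_sum, ← Finset.sum_add_distrib]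
      refine Finset.sum_le_sum fun l _ => ?_
      nlinarith [sq_nonneg (φ l (i k) v - φ l (j k) v)]
    have h4 : ∑ l ∈ Finset.range M, ((if l = M then (1 / 2 : ℝ) • (a (i k) - a (j k)) else
        (1 / 2 : ℝ) • (φ l (i k) + φ l (j k))) v) ^ 2 =
        ∑ l ∈ Finset.range M, ((1 / 2 : ℝ) * (φ l (i k) v + φ l (j k) v)) ^ 2 := by
      refine Finset.sum_congr rfl fun l hl => ?_
      rw [if_neg (Finset.mem_range.1 hl).ne]
      simp [mul_add]
    rw [Finset.sum_range_succ, h4]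
    simp only [if_true, LinearMap.smul_apply, LinearMap.add_apply, LinearMap.sub_apply,
      smul_eq_mul]
    nlinarith
  · intro l hl k
    rcases eq_or_ne l M with rfl | hne
    · have := hij k
      simp only [if_true, Function.update_self, LinearMap.smul_apply, LinearMap.sub_apply,
        smul_eq_mul]
      linarith
    · have h1 := h.large l (by omega) (i k)
      have h2 := h.large l (by omega) (j k)
      rw [Function.update_of_ne hne]
      simp only [if_neg hne, LinearMap.smul_apply, LinearMap.add_apply, smul_eq_mul]
      linarith

/-- If all tail blocks of a bounded sequence of functionals oscillate by at least `ω` somewhere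
on `K`, there is a sequence of functionals which is pointwise square-summable, hence null,
but not uniformly null on `K`. -/
lemma hasNullSeq_of_gap {p : Seminorm ℝ L} {K : Set L} {w : ℕ → L →ₗ[ℝ] ℝ}
    (hw : ∀ k x, |w k x| ≤ p x) {ω : ℝ} (hω : 0 < ω)
    (hgap : ∀ a, IsTailBlock a w → ∃ x ∈ K, ∀ N, ∃ i ≥ N, ∃ j ≥ N, ω ≤ a i x - a j x) :
    HasNullSeq p K := by
  let S : Type _ := (ℕ → L) × (ℕ → L →ₗ[ℝ] ℝ) × (ℕ → ℕ → L →ₗ[ℝ] ℝ)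
  have hstep : ∀ (M : ℕ) (s : S), ∃ s' : S, BesselStage p K w ω M s.1 s.2.1 s.2.2 →
      BesselStage p K w ω (M + 1) s'.1 s'.2.1 s'.2.2 ∧ ∀ l < M, s'.1 l = s.1 l := by
    intro M s
    by_cases h : BesselStage p K w ω M s.1 s.2.1 s.2.2
    · obtain ⟨y, a', φ', h'⟩ := h.exists_succ hgap
      exact ⟨(_, a', φ'), fun _ => ⟨h', fun l hl => Function.update_of_ne hl.ne _ _⟩⟩
    · exact ⟨s, fun h' => absurd h' h⟩
  choose next hnext using hstep
  let s : ℕ → S := fun M => Nat.rec (0, w, 0) next M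
  have hs : ∀ M, BesselStage p K w ω M (s M).1 (s M).2.1 (s M).2.2 := by
    intro M
    induction M with
    | zero =>
      refine ⟨.refl w, by simp, fun k v => ?_, by simp⟩
      have := sq_le_sq' (abs_le.1 (hw k v)).1 (abs_le.1 (hw k v)).2
      simpa [s] using this
    | succ M ih => exact (hnext M (s M) ih).1
  have hx : ∀ l d, (s (l + 1 + d)).1 l = (s (l + 1)).1 l := by
    intro l d
    induction d with
    | zero => rfl
    | succ d ih => exact ((hnext _ _ (hs (l + 1 + d))).2 l (by omega)).trans ih
  let c : ℕ → L := fun l => (s (l + 1)).1 l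
  have hc : ∀ l M, l < M → (s M).1 l = c l := by
    intro l M hlM
    obtain ⟨d, rfl⟩ := Nat.exists_eq_add_of_le hlM
    exact hx l d
  -- The functionals at stage `M`, set to zero from index `M` on.
  let Φ : ℕ → ℕ → L →ₗ[ℝ] ℝ := fun M l => if l < M then (s M).2.2 l 0 else 0
  have hΦsum : ∀ M n v, ∑ l ∈ Finset.range n, Φ M l v ^ 2 ≤ p v ^ 2 := by
    intro M n v
    have h1 := (hs M).bessel 0 v
    have h2 : ∑ l ∈ Finset.range n, Φ M l v ^ 2 ≤
        ∑ l ∈ Finset.range M, (s M).2.2 l 0 v ^ 2 := by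
      calc ∑ l ∈ Finset.range n, Φ M l v ^ 2
          ≤ ∑ l ∈ Finset.range (max n M), Φ M l v ^ 2 :=
            Finset.sum_le_sum_of_subset_of_nonneg
              (Finset.range_subset_range.2 (le_max_left _ _)) fun _ _ _ => sq_nonneg _
        _ = ∑ l ∈ Finset.range M, Φ M l v ^ 2 := by
            refine (Finset.sum_subset (Finset.range_subset_range.2 (le_max_right _ _)) ?_).symm
            intro l _ hl
            simp [Φ, if_neg (fun h => hl (Finset.mem_range.2 h))]
        _ = _ := Finset.sum_congr rfl fun l hl => by simp [Φ, if_pos (Finset.mem_range.1 hl)]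
    nlinarith [sq_nonneg ((s M).2.1 0 v)]
  have hΦp : ∀ M l v, |Φ M l v| ≤ p v := by
    intro M l v
    refine abs_le_of_sq_le_sq ?_ (apply_nonneg p v)
    refine le_trans ?_ (hΦsum M (l + 1) v)
    exact Finset.single_le_sum (f := fun l => Φ M l v ^ 2) (fun _ _ => sq_nonneg _)
      (Finset.self_mem_range_succ l)
  -- A limit of the stages along an ultrafilter.
  have hlim : ∀ l v, ∃ r, Tendsto (fun M => Φ M l v) (hyperfilter ℕ : Filter ℕ) (𝓝 r) := by
    intro l v
    obtain ⟨r, -, hr⟩ := (isCompact_Icc (a := -p v) (b := p v)).ultrafilter_le_nhds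
      ((hyperfilter ℕ).map fun M : ℕ => Φ M l v) (by
        rw [le_principal_iff]
        change ∀ᶠ M in (hyperfilter ℕ : Filter ℕ), Φ M l v ∈ Icc (-p v) (p v)
        exact Eventually.of_forall fun M => abs_le.1 (hΦp M l v))
    exact ⟨r, hr⟩
  choose r hr using hlim
  let g : ℕ → L →ₗ[ℝ] ℝ := fun l =>
    { toFun := r l
      map_add' := fun u v => tendsto_nhds_unique (hr l (u + v)) (by
        simpa only [map_add] using (hr l u).add (hr l v))
      map_smul' := fun t v => tendsto_nhds_unique (hr l (t • v)) (by
        simpa only [map_smul, smul_eq_mul, RingHom.id_apply] using (hr l v).const_mul t) }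
  have hgsum : ∀ n v, ∑ l ∈ Finset.range n, g l v ^ 2 ≤ p v ^ 2 := fun n v =>
    le_of_tendsto' (tendsto_finsetSum _ fun l _ => (hr l v).pow 2) fun M => hΦsum M n v
  refine ⟨g, c, ω / 2, half_pos hω, fun k x => ?_, fun k => ?_, fun x _ => ?_, fun k => ?_⟩
  · exact le_of_tendsto' (hr k x).abs fun M => hΦp M k x
  · exact (hs (k + 1)).mem k (Nat.lt_succ_self k)
  · have hsum : Summable fun l => g l x ^ 2 :=
      summable_of_sum_range_le (fun _ => sq_nonneg _) fun n => hgsum n x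
    have := hsum.tendsto_atTop_zero.sqrt
    simp only [Real.sqrt_sq_eq_abs, Real.sqrt_zero] at this
    exact tendsto_zero_iff_abs_tendsto_zero _ |>.2 this
  · refine ge_of_tendsto (hr k (c k)) ?_
    have hev : ∀ᶠ M in (hyperfilter ℕ : Filter ℕ), k < M :=
      Nat.hyperfilter_le_atTop (eventually_gt_atTop k)
    filter_upwards [hev] with M hM
    have := (hs M).large k hM 0
    rw [hc k M hM] at this
    simpa [Φ, hM] using this

/-- For a bounded sequence of functionals, either some tail block converges pointwise
on `K`, or `HasNullSeq p K` holds. -/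
lemma exists_isTailBlock_cauchySeq_or_hasNullSeq {p : Seminorm ℝ L} {K : Set L}
    {y : ℕ → L →ₗ[ℝ] ℝ} (hy : ∀ k x, |y k x| ≤ p x) :
    (∃ z, IsTailBlock z y ∧ ∀ x ∈ K, CauchySeq fun k => z k x) ∨ HasNullSeq p K := by
  by_cases hgap : ∃ w, IsTailBlock w y ∧ ∃ ω > 0, ∀ a, IsTailBlock a w →
      ∃ x ∈ K, ∀ N, ∃ i ≥ N, ∃ j ≥ N, ω ≤ a i x - a j x
  · right
    obtain ⟨w, hw, ω, hω, h⟩ := hgap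
    obtain ⟨N, hN⟩ := eventually_atTop.1 (hw.exists_dominated hy)
    refine hasNullSeq_of_gap (w := fun k => w (k + N)) (fun k => hN _ (by omega)) hω
      fun a ha => h a (ha.trans fun M => ?_)
    filter_upwards [eventually_ge_atTop M] with k hk
    exact subset_convexHull ℝ _ ⟨k + N, by simp; omega, rfl⟩
  · left
    push Not at hgap
    have hstep : ∀ (n : ℕ) (w : ℕ → L →ₗ[ℝ] ℝ), ∃ a, IsTailBlock w y → IsTailBlock a w ∧
        ∀ x ∈ K, ∃ N, ∀ i ≥ N, ∀ j ≥ N, a i x - a j x < 1 / ((n : ℝ) + 1) := by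
      intro n w
      by_cases hw : IsTailBlock w y
      · obtain ⟨a, ha⟩ := hgap w hw (1 / ((n : ℝ) + 1)) (by positivity)
        exact ⟨a, fun _ => ha⟩
      · exact ⟨w, fun h => absurd h hw⟩
    choose next hnext using hstep
    let Y : ℕ → ℕ → L →ₗ[ℝ] ℝ := fun n => Nat.rec y next n
    have hYy : ∀ n, IsTailBlock (Y n) y := by
      intro n
      induction n with
      | zero => exact .refl _
      | succ n ih => exact (hnext n _ ih).1.trans ih
    obtain ⟨v, hv⟩ := IsTailBlock.exists_diagonal fun n => (hnext n _ (hYy n)).1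
    refine ⟨v, hv 0, fun x hx => Metric.cauchySeq_iff'.2 fun ε hε => ?_⟩
    obtain ⟨n, hn⟩ := exists_nat_one_div_lt hε
    obtain ⟨N, hN⟩ := (hnext n _ (hYy n)).2 x hx
    obtain ⟨M, hM⟩ := eventually_atTop.1 (hv (n + 1) N)
    refine ⟨M, fun k hk => ?_⟩
    -- The values at `x` of the far terms of `Y (n + 1)` lie within `1 / (n + 1)` of each other,
    -- and the same holds for convex combinations of these terms.
    have key : ∀ i ≥ N, Y (n + 1) i x - v M x ≤ 1 / ((n : ℝ) + 1) ∧
        v M x - Y (n + 1) i x ≤ 1 / ((n : ℝ) + 1) := by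
      intro i hi
      have := apply_mem_of_mem_convexHull (x := x)
        (S := Icc (Y (n + 1) i x - 1 / ((n : ℝ) + 1)) (Y (n + 1) i x + 1 / ((n : ℝ) + 1)))
        (convex_Icc _ _) (by
          rintro _ ⟨j, hj, rfl⟩
          have h1 := hN i hi j hj
          have h2 := hN j hj i hi
          constructor
          · change Y (n + 1) i x - Y (n + 1) j x < _ at h1
            linarith
          · change Y (n + 1) j x - Y (n + 1) i x < _ at h2
            linarith) (hM M le_rfl)
      constructor <;> linarith [this.1, this.2]
    have := apply_mem_of_mem_convexHull (x := x)
      (S := Icc (v M x - 1 / ((n : ℝ) + 1)) (v M x + 1 / ((n : ℝ) + 1)))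
      (convex_Icc _ _) (by
        rintro _ ⟨j, hj, rfl⟩
        constructor <;> linarith [(key j hj).1, (key j hj).2]) (hM k hk)
    rw [Real.dist_eq, abs_lt]
    constructor <;> linarith [this.1, this.2]

end Dichotomy

/-! ### Null sequences from triangular systems -/

section Triangular

variable {L : Type*} [AddCommGroup L] [Module ℝ L]

/-- The half difference of two functionals dominated by `p` is dominated by `p`. -/
lemma abs_half_sub_le {p : Seminorm ℝ L} {f g : L →ₗ[ℝ] ℝ} (hf : ∀ x, |f x| ≤ p x)
    (hg : ∀ x, |g x| ≤ p x) (x : L) : |((1 / 2 : ℝ) • (f - g)) x| ≤ p x := by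
  have h1 := abs_le.1 (hf x)
  have h2 := abs_le.1 (hg x)
  simp only [LinearMap.smul_apply, LinearMap.sub_apply, smul_eq_mul]
  rw [abs_le]
  constructor <;> linarith [h1.1, h1.2, h2.1, h2.2]

/-- A countable family of functionals is controlled on `K` by a countable subset of `K`: every
functional in their span takes on this subset values as close as desired to its values on `K`. -/
lemma exists_seq_approx_span {K : Set L} (hK : K.Nonempty) (ψ : ℕ → L →ₗ[ℝ] ℝ) :
    ∃ d : ℕ → L, (∀ n, d n ∈ K) ∧ ∀ f ∈ Submodule.span ℝ (range ψ), ∀ x ∈ K, ∀ ε > 0,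
      ∃ n, |f (d n) - f x| < ε := by
  let Ψ : K → ℕ → ℝ := fun x j => ψ j x
  let _ : TopologicalSpace K := TopologicalSpace.induced Ψ inferInstance
  have hΨ : Continuous Ψ := continuous_induced_dom
  have : SecondCountableTopology K :=
    TopologicalSpace.secondCountableTopology_induced K (ℕ → ℝ) Ψ
  have : Nonempty K := hK.to_subtype
  refine ⟨fun n => TopologicalSpace.denseSeq K n, fun n => (TopologicalSpace.denseSeq K n).2,
    fun f hf x hx ε hε => ?_⟩
  have hcont : Continuous fun y : K => f y := by
    induction hf using Submodule.span_induction with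
    | mem f hf =>
      obtain ⟨j, rfl⟩ := hf
      exact (continuous_apply j).comp hΨ
    | zero => exact continuous_const
    | add f g _ _ hf hg => exact hf.add hg
    | smul t f _ hf => exact continuous_const.mul hf
  have hopen : IsOpen {y : K | |f y - f x| < ε} :=
    isOpen_lt (hcont.sub continuous_const).abs continuous_const
  obtain ⟨n, hn⟩ := (TopologicalSpace.denseRange_denseSeq K).exists_mem_open hopen
    ⟨⟨x, hx⟩, by simpa using hε⟩
  exact ⟨n, hn⟩

/-- A bounded sequence of functionals has a subsequence converging pointwise on a given
countable set. -/
lemma exists_strictMono_cauchySeq_apply {p : Seminorm ℝ L} {ψ : ℕ → L →ₗ[ℝ] ℝ}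
    (hψ : ∀ k x, |ψ k x| ≤ p x) (d : ℕ → L) :
    ∃ τ : ℕ → ℕ, StrictMono τ ∧ ∀ n, CauchySeq fun k => ψ (τ k) (d n) := by
  have hc : IsCompact (Set.pi univ fun n => Icc (-p (d n)) (p (d n))) :=
    isCompact_univ_pi fun n => isCompact_Icc
  obtain ⟨r, -, τ, hτ, hr⟩ := hc.tendsto_subseq (x := fun k n => ψ k (d n))
    fun k n _ => abs_le.1 (hψ k (d n))
  exact ⟨τ, hτ, fun n => (tendsto_pi_nhds.1 hr n).cauchySeq⟩

/-- A bounded triangular system of functionals and points of `K` yields a sequence of functionals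
that is null pointwise on `K` but not uniformly. A subsequence of `ψ` converges
on a countable set `D ⊆ K` on which the span of `ψ` is controlled. If it converges on all of `K`,
successive differences will do. Otherwise some differences tend to zero on `D` and are bounded
below at a point of `K`; their convex combinations are then not small on `D`, so tail blocks of
them converging on `K` do not converge uniformly on `D`. -/
lemma hasNullSeq_of_triangular {p : Seminorm ℝ L} {K : Set L} {ψ : ℕ → L →ₗ[ℝ] ℝ} {c : ℕ → L}
    {δ : ℝ} (hδ : 0 < δ) (hψ : ∀ k x, |ψ k x| ≤ p x) (hc : ∀ k, c k ∈ K)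
    (hlow : ∀ i j, i < j → ψ j (c i) = 0) (hdiag : ∀ k, δ ≤ ψ k (c k)) : HasNullSeq p K := by
  obtain ⟨d, hdK, hd⟩ := exists_seq_approx_span ⟨c 0, hc 0⟩ ψ
  obtain ⟨τ, hτ, hτd⟩ := exists_strictMono_cauchySeq_apply hψ d
  by_cases hconv : ∀ x ∈ K, CauchySeq fun k => ψ (τ k) x
  · refine ⟨fun k => (1 / 2 : ℝ) • (ψ (τ k) - ψ (τ (k + 1))), fun k => c (τ k), δ / 2,
      half_pos hδ, fun k => abs_half_sub_le (hψ _) (hψ _), fun k => hc _, fun x hx => ?_,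
      fun k => ?_⟩
    · obtain ⟨r, hr⟩ := cauchySeq_tendsto_of_complete (hconv x hx)
      have := (hr.sub (hr.comp (tendsto_add_atTop_nat 1))).const_mul (1 / 2 : ℝ)
      simpa using this
    · have h1 := hdiag (τ k)
      have h2 := hlow _ _ (hτ (Nat.lt_succ_self k))
      simp only [LinearMap.smul_apply, LinearMap.sub_apply, smul_eq_mul, Nat.succ_eq_add_one] at *
      linarith
  push Not at hconv
  obtain ⟨x₀, hx₀, hx₀'⟩ := hconv
  obtain ⟨ε, hε, hosc⟩ : ∃ ε > 0, ∀ N, ∃ i ≥ N, ∃ j ≥ N, ε ≤ ψ (τ i) x₀ - ψ (τ j) x₀ := by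
    by_contra! h
    refine hx₀' (Metric.cauchySeq_iff.2 fun ε hε => ?_)
    obtain ⟨N, hN⟩ := h ε hε
    refine ⟨N, fun m hm n hn => ?_⟩
    rw [Real.dist_eq, abs_lt]
    constructor <;> linarith [hN m hm n hn, hN n hn m hm]
  -- The functionals `y k` tend to `0` at each `d n`, but are at least `ε / 2` at `x₀`.
  choose i hi j hj hij using hosc
  let y : ℕ → L →ₗ[ℝ] ℝ := fun k => (1 / 2 : ℝ) • (ψ (τ (i k)) - ψ (τ (j k)))
  have hyspan : ∀ k, y k ∈ Submodule.span ℝ (range ψ) := fun k =>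
    Submodule.smul_mem _ _ (Submodule.sub_mem _ (Submodule.subset_span ⟨_, rfl⟩)
      (Submodule.subset_span ⟨_, rfl⟩))
  have hyp : ∀ k x, |y k x| ≤ p x := fun k => abs_half_sub_le (hψ _) (hψ _)
  rcases exists_isTailBlock_cauchySeq_or_hasNullSeq (K := K) hyp with ⟨z', hz', hz'K⟩ | h
  swap
  · exact h
  obtain ⟨N₀, hN₀⟩ := eventually_atTop.1 (hz' 0)
  -- The first terms of a tail block are unrestricted, hence the shift.
  let z : ℕ → L →ₗ[ℝ] ℝ := fun k => z' (k + N₀)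
  have hzmem : ∀ k, z k ∈ convexHull ℝ (range y) := fun k =>
    convexHull_mono (image_subset_range _ _) (hN₀ _ (by omega))
  have hzp : ∀ k x, |z k x| ≤ p x := fun k => by
    refine convexHull_min ?_ (convex_dominated p) (hzmem k)
    rintro _ ⟨l, rfl⟩
    exact hyp l
  have hzspan : ∀ k, z k ∈ Submodule.span ℝ (range ψ) := fun k => by
    refine convexHull_min ?_ (Submodule.convex _) (hzmem k)
    rintro _ ⟨l, rfl⟩
    exact hyspan l
  have hzx₀ : ∀ k, ε / 2 ≤ z k x₀ := fun k => by
    refine apply_mem_of_mem_convexHull (S := Ici (ε / 2)) (convex_Ici _) ?_ (hzmem k)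
    rintro _ ⟨l, rfl⟩
    have := hij l
    simp only [y, LinearMap.smul_apply, LinearMap.sub_apply, smul_eq_mul, mem_Ici]
    linarith
  have hzd : ∀ n, Tendsto (fun k => z k (d n)) atTop (𝓝 0) := fun n => by
    refine (Metric.tendsto_atTop.2 fun η hη => ?_ : Tendsto (fun k => z' k (d n)) _ _).comp
      (tendsto_add_atTop_nat N₀)
    obtain ⟨N, hN⟩ := Metric.cauchySeq_iff.1 (hτd n) η hη
    obtain ⟨M, hM⟩ := eventually_atTop.1 (hz' N)
    refine ⟨M, fun k hk => ?_⟩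
    have := apply_mem_of_mem_convexHull (x := d n) (S := Icc (-(η / 2)) (η / 2))
      (convex_Icc _ _) (by
        rintro _ ⟨l, hl, rfl⟩
        have := hN (i l) (le_trans hl (hi l)) (j l) (le_trans hl (hj l))
        rw [Real.dist_eq, abs_lt] at this
        simp only [y, LinearMap.smul_apply, LinearMap.sub_apply, smul_eq_mul]
        constructor <;> linarith [this.1, this.2]) (hM k hk)
    rw [Real.dist_eq, sub_zero, abs_lt]
    constructor <;> linarith [this.1, this.2]
  -- As `z k` lies in the span of `ψ`, it is not small on the countable set either. So `z k` differs
  -- at some `d (n k)` from a later term `z (l k)`, which is small there.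
  have hn : ∀ k, ∃ n, ε / 4 ≤ z k (d n) := fun k => by
    obtain ⟨n, hn⟩ := hd (z k) (hzspan k) x₀ hx₀ (ε / 4) (by positivity)
    rw [abs_lt] at hn
    exact ⟨n, by linarith [hn.1, hzx₀ k]⟩
  choose n hn using hn
  have hl : ∀ k, ∃ l, k ≤ l ∧ z l (d (n k)) < ε / 8 := fun k =>
    ((eventually_ge_atTop k).and
      ((hzd (n k)).eventually (gt_mem_nhds (by positivity : (0 : ℝ) < ε / 8)))).exists
  choose l hkl hl using hl
  refine ⟨fun k => (1 / 2 : ℝ) • (z k - z (l k)), fun k => d (n k), ε / 16, by positivity,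
    fun k => abs_half_sub_le (hzp _) (hzp _), fun k => hdK _, fun x hx => ?_, fun k => ?_⟩
  · obtain ⟨r, hr⟩ := cauchySeq_tendsto_of_complete (hz'K x hx)
    have hr' : Tendsto (fun k => z k x) atTop (𝓝 r) := hr.comp (tendsto_add_atTop_nat N₀)
    have := (hr'.sub (hr'.comp (tendsto_atTop_mono hkl tendsto_id))).const_mul (1 / 2 : ℝ)
    simpa using this
  · simp only [LinearMap.smul_apply, LinearMap.sub_apply, smul_eq_mul]
    linarith [hn k, hl k]

/-- A functional dominated by `p`, vanishing on the subspace `S`, and equal to the lower bound `δ`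
of the `p`-distance from `c` to `S` at the point `c`. -/
lemma exists_dominated_vanishing (p : Seminorm ℝ L) (S : Submodule ℝ L) {c : L} {δ : ℝ}
    (hδ : 0 < δ) (hc : ∀ v ∈ S, δ ≤ p (c - v)) :
    ∃ g : L →ₗ[ℝ] ℝ, (∀ x, |g x| ≤ p x) ∧ (∀ v ∈ S, g v = 0) ∧ g c = δ := by
  have hcS : c ∉ S := fun h => by
    have := hc c h
    rw [sub_self, map_zero] at this
    linarith
  let f₀ : L →ₗ.[ℝ] ℝ := ⟨S, 0⟩
  let f : L →ₗ.[ℝ] ℝ := f₀.supSpanSingleton c δ hcS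
  have hf : ∀ v ∈ S, ∀ (t : ℝ) (h : v + t • c ∈ f.domain), f ⟨v + t • c, h⟩ = t * δ := by
    intro v hv t h
    have := LinearPMap.supSpanSingleton_apply_mk f₀ c δ hcS v hv t
    rw [this]
    simp [f₀]
  obtain ⟨g, hg, hgp⟩ := exists_extension_of_le_sublinear f p
    (fun t ht x => by rw [map_smul_eq_mul, Real.norm_of_nonneg ht.le])
    (fun x y => map_add_le_add p x y) (by
      rintro ⟨x, hx⟩
      have hx' := hx
      rw [show f.domain = S ⊔ Submodule.span ℝ {c} from rfl, Submodule.mem_sup] at hx'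
      obtain ⟨v, hv, w, hw, rfl⟩ := hx'
      obtain ⟨t, rfl⟩ := Submodule.mem_span_singleton.1 hw
      rw [hf v hv t hx]
      rcases le_or_gt t 0 with ht | ht
      · exact (mul_nonpos_of_nonpos_of_nonneg ht hδ.le).trans (apply_nonneg p _)
      · have h1 := hc (-(t⁻¹ • v)) (S.neg_mem (S.smul_mem _ hv))
        have h2 : v + t • c = t • (c - -(t⁻¹ • v)) := by
          rw [sub_neg_eq_add, smul_add, smul_smul, mul_inv_cancel₀ ht.ne', one_smul, add_comm]
        change t * δ ≤ p (v + t • c)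
        rw [h2, map_smul_eq_mul, Real.norm_of_nonneg ht.le]
        exact mul_le_mul_of_nonneg_left h1 ht.le)
  refine ⟨g, fun x => abs_le.2 ⟨?_, hgp x⟩, fun v hv => ?_, ?_⟩
  · have := hgp (-x)
    rw [map_neg, map_neg_eq_map] at this
    linarith
  · have hmem : v + (0 : ℝ) • c ∈ f.domain := by
      rw [zero_smul, add_zero]
      exact (le_sup_left : S ≤ S ⊔ Submodule.span ℝ {c}) hv
    have := hg ⟨_, hmem⟩
    rw [hf v hv 0 hmem] at this
    simpa using this
  · have hmem : 0 + (1 : ℝ) • c ∈ f.domain := by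
      rw [zero_add, one_smul]
      exact (le_sup_right : _ ≤ S ⊔ Submodule.span ℝ {c}) (Submodule.mem_span_singleton_self c)
    have := hg ⟨_, hmem⟩
    rw [hf 0 S.zero_mem 1 hmem] at this
    simpa using this

/-- If no finite-dimensional subspace comes uniformly `p`-close to all points of `K`, there is a
sequence of functionals dominated by `p` that is null pointwise on `K` but not uniformly. -/
lemma hasNullSeq_of_forall_finite {p : Seminorm ℝ L} {K : Set L} {δ : ℝ} (hδ : 0 < δ)
    (h : ∀ A : Set L, A.Finite → ∃ c ∈ K, ∀ v ∈ Submodule.span ℝ A, δ ≤ p (c - v)) :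
    HasNullSeq p K := by
  obtain ⟨c, hc⟩ : ∃ c : ℕ → L, ∀ k, c k ∈ K ∧
      ∀ v ∈ Submodule.span ℝ (c '' Iio k), δ ≤ p (c k - v) := by
    choose pick hpickK hpick using h
    let A : ℕ → {A : Set L // A.Finite} := fun n =>
      Nat.rec ⟨∅, finite_empty⟩ (fun _ B => ⟨insert (pick B.1 B.2) B.1, B.2.insert _⟩) n
    have hA : Monotone fun n => (A n).1 := monotone_nat_of_le_succ fun n => subset_insert _ _
    refine ⟨fun n => pick (A n).1 (A n).2, fun k => ⟨hpickK _ _, fun v hv => hpick _ _ v ?_⟩⟩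
    refine Submodule.span_mono ?_ hv
    rintro _ ⟨i, hi, rfl⟩
    exact hA (Nat.succ_le_of_lt hi) (mem_insert _ _)
  choose ψ hψ hψ0 hψd using fun k => exists_dominated_vanishing p _ hδ (hc k).2
  exact hasNullSeq_of_triangular hδ hψ (fun k => (hc k).1)
    (fun i j hij => hψ0 j _ (Submodule.subset_span ⟨i, hij, rfl⟩)) fun k => (hψd k).ge

end Triangular

/-! ### Seminorms on non-separable cones -/

section NonSeparable

variable {L : Type*} [AddCommGroup L] [Module ℝ L]

lemma IsConvexCone.smul_mem {C : Set L} (hC : IsConvexCone C) {t : ℝ} (ht : 0 ≤ t) {x : L}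
    (hx : x ∈ C) : t • x ∈ C := by
  rw [← hC.2]
  exact Set.smul_mem_smul ht hx

lemma IsConvexCone.add_mem {C : Set L} (hC : IsConvexCone C) {x y : L} (hx : x ∈ C)
    (hy : y ∈ C) : x + y ∈ C := by
  have := hC.1 (hC.smul_mem zero_le_two hx) (hC.smul_mem zero_le_two hy)
    (by norm_num : (0 : ℝ) ≤ 1 / 2) (by norm_num : (0 : ℝ) ≤ 1 / 2) (by norm_num)
  simpa [smul_smul] using this

/-- The unit balls of continuous seminorms form a basis of neighbourhoods of the origin in a
locally convex space. -/
lemma exists_continuous_seminorm_subset [TopologicalSpace L] [IsTopologicalAddGroup L]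
    [ContinuousSMul ℝ L] [LocallyConvexSpace ℝ L] {U : Set L} (hU : U ∈ 𝓝 (0 : L)) :
    ∃ p : Seminorm ℝ L, Continuous p ∧ {x | p x ≤ 1} ⊆ U := by
  obtain ⟨V, ⟨hV0, hVo, hVb, hVc⟩, hVU⟩ := (nhds_hasBasis_absConvex_open ℝ L).mem_iff.1 hU
  have hV : V ∈ 𝓝 (0 : L) := hVo.mem_nhds hV0
  let q : Seminorm ℝ L := gaugeSeminorm hVb hVc (absorbent_nhds_zero hV)
  have hq : Continuous q := continuous_gauge hVc hV
  refine ⟨(2 : NNReal) • q, ?_, fun x hx => hVU ?_⟩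
  · exact hq.const_smul (2 : NNReal)
  · have hx' : 2 * q x ≤ 1 := hx
    change x ∈ V
    rw [← gaugeSeminorm_ball_one (hs₀ := hVb) (hs₁ := hVc) (hs₂ := absorbent_nhds_zero hV) hVo,
      Seminorm.mem_ball_zero]
    change q x < 1
    linarith

/-- For a non-separable cone there is a continuous seminorm, as large as desired, in which no
finite-dimensional subspace comes uniformly close to the unit ball of the cone: otherwise
countably many finite sets would span a subspace whose closure contains the cone. -/
lemma exists_seminorm_forall_finite [MetricSpace L] [IsTopologicalAddGroup L]
    [ContinuousSMul ℝ L] [LocallyConvexSpace ℝ L] {C : Set L} (hC : IsConvexCone C)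
    (hsep : ¬ TopologicalSpace.SeparableSpace C) {p₀ : Seminorm ℝ L} (hp₀ : Continuous p₀) :
    ∃ p : Seminorm ℝ L, Continuous p ∧ p₀ ≤ p ∧ ∃ δ > 0, ∀ A : Set L, A.Finite →
      ∃ c ∈ {x | x ∈ C ∧ p x ≤ 1}, ∀ v ∈ Submodule.span ℝ A, δ ≤ p (c - v) := by
  by_contra! h
  obtain ⟨U, hU⟩ := (𝓝 (0 : L)).exists_antitone_basis
  choose q hq hqU using fun n => exists_continuous_seminorm_subset (hU.mem n)
  have hpc : ∀ n, Continuous (p₀ ⊔ q n : Seminorm ℝ L) := fun n => hp₀.sup (hq n)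
  choose A hAfin hA using fun n m : ℕ =>
    h (p₀ ⊔ q n) (hpc n) le_sup_left (1 / ((m : ℝ) + 1)) (by positivity)
  let T : Set L := ⋃ n, ⋃ m, A n m
  have hT : T.Countable := countable_iUnion fun n => countable_iUnion fun m =>
    (hAfin n m).countable
  have hCT : C ⊆ closure (Submodule.span ℝ T : Set L) := by
    intro x hx
    rw [mem_closure_iff_nhds]
    intro W hW
    have hW0 : (fun y => x - y) ⁻¹' W ∈ 𝓝 (0 : L) :=
      (continuous_const.sub continuous_id).continuousAt.preimage_mem_nhds (by simpa using hW)
    obtain ⟨n, -, hn⟩ := hU.toHasBasis.mem_iff.1 hW0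
    set p : Seminorm ℝ L := p₀ ⊔ q n
    have ht : 0 < p x + 1 := by have := apply_nonneg p x; linarith
    obtain ⟨m, hm⟩ := exists_nat_one_div_lt (inv_pos.2 ht)
    have hxball : p ((p x + 1)⁻¹ • x) ≤ 1 := by
      rw [map_smul_eq_mul, Real.norm_of_nonneg (inv_nonneg.2 ht.le), inv_mul_le_one₀ ht]
      linarith
    obtain ⟨v, hv, hvx⟩ := hA n m _ ⟨hC.smul_mem (inv_nonneg.2 ht.le) hx, hxball⟩
    refine ⟨(p x + 1) • v, ?_, Submodule.smul_mem _ _ (Submodule.span_mono ?_ hv)⟩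
    · have h1 : p (x - (p x + 1) • v) ≤ 1 := by
        have h2 : x - (p x + 1) • v = (p x + 1) • ((p x + 1)⁻¹ • x - v) := by
          rw [smul_sub, smul_inv_smul₀ ht.ne']
        rw [h2, map_smul_eq_mul, Real.norm_of_nonneg ht.le, ← le_inv_mul_iff₀ ht, mul_one]
        exact (hvx.trans hm).le
      have h3 : q n (x - (p x + 1) • v) ≤ 1 :=
        ((le_sup_right : q n ≤ p) _).trans h1
      simpa using hn (hqU n h3)
    · exact (subset_iUnion (A n) m).trans (subset_iUnion (fun n => ⋃ m, A n m) n)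
  exact hsep (hT.isSeparable.span.closure.mono hCT).separableSpace

end NonSeparable

/-! ### Markers -/

section Markers

variable {L : Type*} [AddCommGroup L] [Module ℝ L]

/-- The piecewise linear path through the points `c 0, c 1, c 2, …` -/
lemma exists_piecewise_linear [TopologicalSpace L] [ContinuousAdd L] [ContinuousSMul ℝ L]
    (c : ℕ → L) : ∃ γ : C(ℝ, L), ∀ (k : ℕ) (s : ℝ), 0 ≤ s → s ≤ 1 →
      γ (k + s) = (1 - s) • c k + s • c (k + 1) := by
  refine ⟨⟨fun t => ∑ᶠ k : ℕ, max 0 (1 - |t - k|) • c k, ?_⟩, fun k s hs0 hs1 => ?_⟩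
  · refine continuous_finsum (fun k => by fun_prop) fun t => ?_
    obtain ⟨N, hN⟩ := exists_nat_gt (t + 2)
    refine ⟨Iio (t + 1), Iio_mem_nhds (by linarith), (finite_le_nat N).subset ?_⟩
    rintro k ⟨u, hu, hut⟩
    by_contra! hk
    have hk' : (N : ℝ) < k := by exact_mod_cast not_le.1 hk
    have hu' : u < t + 1 := hut
    refine hu ?_
    change max 0 (1 - |u - k|) • c k = 0
    rw [max_eq_left, zero_smul]
    have := neg_le_abs (u - k)
    linarith
  · change ∑ᶠ j : ℕ, max 0 (1 - |(k + s : ℝ) - j|) • c j = _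
    rw [finsum_eq_sum_of_support_subset (s := {k, k + 1})]
    · rw [Finset.sum_pair (by simp)]
      congr 2
      · rw [add_sub_cancel_left, abs_of_nonneg hs0, max_eq_right (by linarith)]
      · push_cast
        rw [abs_of_nonpos (by linarith), max_eq_right (by linarith)]
        ring
    · intro j hj
      by_contra hjk
      simp only [Finset.coe_insert, Finset.coe_singleton, mem_insert_iff, mem_singleton_iff,
        not_or] at hjk
      refine hj ?_
      change max 0 (1 - |(k + s : ℝ) - j|) • c j = 0
      rw [max_eq_left, zero_smul]
      rcases lt_or_gt_of_ne hjk.1 with h | h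
      · have h' : (j : ℝ) + 1 ≤ k := by exact_mod_cast h
        have := le_abs_self ((k : ℝ) + s - j)
        linarith
      · have h' : (k : ℝ) + 2 ≤ j := by
          have : k + 2 ≤ j := by omega
          exact_mod_cast this
        have := neg_le_abs ((k : ℝ) + s - j)
        linarith

/-- Two points with markers attached are far apart, the markers being points on segments
`[c a, c a']` and `[c b, c b']` with pairwise distinct indices, the largest of which is `b'`.
The functionals `g e` are tested for `e` running downwards through the indices: if the
difference is small, then all coefficients would have to be small. -/
lemma le_seminorm_sub_of_lt {p : Seminorm ℝ L} {g : ℕ → L →ₗ[ℝ] ℝ} {c : ℕ → L} {δ η : ℝ}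
    (hδ : 0 < δ) (hδ1 : δ ≤ 1) (hη : η = δ ^ 3 / 128) (hg : ∀ k x, |g k x| ≤ p x)
    (hc : ∀ k, p (c k) ≤ 1) (hdiag : ∀ k, δ ≤ g k (c k)) (hlow : ∀ j k, j < k → |g k (c j)| ≤ η)
    {x y : L} {a a' b b' : ℕ} (haa : a < a') (hab' : a' < b') (hbb : b < b') (hab : a ≠ b)
    (ha'b : a' ≠ b) {s r : ℝ} (hs0 : 0 ≤ s) (hs1 : s ≤ 1) (hr0 : 0 ≤ r) (hr1 : r ≤ 1)
    (hx : ∀ e, a ≤ e → |g e x| ≤ η) (hy : ∀ e, b ≤ e → |g e y| ≤ η) :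
    η ≤ p ((x + ((1 - s) • c a + s • c a')) - (y + ((1 - r) • c b + r • c b'))) := by
  by_contra! hP
  have hη0 : 0 < η := by rw [hη]; positivity
  have hgc : ∀ e j, |g e (c j)| ≤ 1 := fun e j => (hg e _).trans (hc j)
  have hexp : ∀ e, |g e x + ((1 - s) * g e (c a) + s * g e (c a')) -
      (g e y + ((1 - r) * g e (c b) + r * g e (c b')))| < η := by
    intro e
    have h := hg e ((x + ((1 - s) • c a + s • c a')) - (y + ((1 - r) • c b + r • c b')))
    simp only [map_sub, map_add, map_smul, smul_eq_mul] at h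
    exact h.trans_lt hP
  have hmul : ∀ {t u v : ℝ}, 0 ≤ t → |u| ≤ v → -(t * v) ≤ t * u ∧ t * u ≤ t * v := by
    intro t u v ht hu
    rw [abs_le] at hu
    constructor <;> nlinarith [hu.1, hu.2]
  have hs1' : 0 ≤ 1 - s := by linarith
  have hr1' : 0 ≤ 1 - r := by linarith
  have hsη : 0 ≤ s * η := mul_nonneg hs0 hη0.le
  have hrη : 0 ≤ r * η := mul_nonneg hr0 hη0.le
  -- Testing with `g b'` shows that `r` is small.
  have hr : r * δ ≤ 5 * η := by
    have h := abs_lt.1 (hexp b')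
    have h1 := abs_le.1 (hx b' (by omega))
    have h2 := abs_le.1 (hy b' (by omega))
    have h3 := hmul hs1' (hlow a b' (by omega))
    have h4 := hmul hs0 (hlow a' b' (by omega))
    have h5 := hmul hr1' (hlow b b' (by omega))
    have h6 := mul_le_mul_of_nonneg_left (hdiag b') hr0
    linarith [h.1, h1.2, h2.1, h3.2, h4.2, h5.1]
  have hη1 : η * 128 = δ ^ 3 := by rw [hη]; ring
  have hr' : r ≤ 5 * δ ^ 2 / 128 := by
    refine le_of_mul_le_mul_right ?_ hδ
    linarith [hη1]
  have hδ2 : δ ^ 2 ≤ δ := by nlinarith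
  have hδ3 : δ ^ 3 ≤ δ ^ 2 := by nlinarith [sq_nonneg δ]
  rcases lt_or_gt_of_ne ha'b with hlt | hgt
  · -- Testing with `g b`.
    have h := abs_lt.1 (hexp b)
    have h1 := abs_le.1 (hx b (by omega))
    have h2 := abs_le.1 (hy b le_rfl)
    have h3 := hmul hs1' (hlow a b (by omega))
    have h4 := hmul hs0 (hlow a' b hlt)
    have h5 := hmul hr0 (hgc b b')
    have h6 := mul_le_mul_of_nonneg_left (hdiag b) hr1'
    have h7 : r * δ ≤ r := by nlinarith
    linarith [h.1, h1.2, h2.1, h3.2, h4.2, h5.1]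
  · -- Testing with `g a'` shows that `s` is small.
    have hs : s * δ ≤ 5 * η + r := by
      have h := abs_lt.1 (hexp a')
      have h1 := abs_le.1 (hx a' haa.le)
      have h2 := abs_le.1 (hy a' hgt.le)
      have h3 := hmul hs1' (hlow a a' haa)
      have h4 := hmul hr1' (hlow b a' hgt)
      have h5 := hmul hr0 (hgc a' b')
      have h6 := mul_le_mul_of_nonneg_left (hdiag a') hs0
      linarith [h.2, h1.1, h2.2, h3.1, h4.2, h5.2]
    have hs' : s ≤ 10 * δ / 128 := by
      refine le_of_mul_le_mul_right ?_ hδ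
      linarith [hη1]
    have h7 : r * δ ≤ r := by nlinarith
    have h8 : s * δ ≤ s := by nlinarith
    rcases lt_or_gt_of_ne hab with hlt' | hgt'
    · have h := abs_lt.1 (hexp b)
      have h1 := abs_le.1 (hx b hlt'.le)
      have h2 := abs_le.1 (hy b le_rfl)
      have h3 := hmul hs1' (hlow a b hlt')
      have h4 := hmul hs0 (hgc b a')
      have h5 := hmul hr0 (hgc b b')
      have h6 := mul_le_mul_of_nonneg_left (hdiag b) hr1'
      linarith [h.1, h1.2, h2.1, h3.2, h4.2, h5.1]
    · have h := abs_lt.1 (hexp a)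
      have h1 := abs_le.1 (hx a le_rfl)
      have h2 := abs_le.1 (hy a hgt'.le)
      have h3 := hmul hs0 (hgc a a')
      have h4 := hmul hr1' (hlow b a hgt')
      have h5 := hmul hr0 (hgc a b')
      have h6 := mul_le_mul_of_nonneg_left (hdiag a) hs1'
      linarith [h.2, h1.1, h2.2, h3.1, h4.2, h5.2]

/-- A null sequence of functionals admits a continuous level function: beyond the level of `x`,
all functionals are small at `x`. -/
lemma exists_continuous_level [TopologicalSpace L] [IsTopologicalAddGroup L]
    {C : Set L} [NormalSpace C] [ParacompactSpace C] {p : Seminorm ℝ L} (hp : Continuous p)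
    {g : ℕ → L →ₗ[ℝ] ℝ}
    (hg : ∀ k x, |g k x| ≤ p x) (hnull : ∀ x ∈ C, Tendsto (fun k => g k x) atTop (𝓝 0))
    {η : ℝ} (hη : 0 < η) :
    ∃ t : C(C, ℝ), ∀ x, 0 ≤ t x ∧ ∀ e : ℕ, t x ≤ e + 1 → |g e x| ≤ η := by
  refine exists_continuous_forall_mem_convex_of_local_const
    (t := fun x : C => {t : ℝ | 0 ≤ t ∧ ∀ e : ℕ, t ≤ e + 1 → |g e x| ≤ η}) ?_ ?_
  · intro x
    refine OrdConnected.convex ⟨fun u hu v hv w hw => ⟨hu.1.trans hw.1, fun e he => ?_⟩⟩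
    exact hu.2 e (hw.1.trans he)
  · intro x
    obtain ⟨N, hN⟩ := Metric.tendsto_atTop.1 (hnull x x.2) (η / 2) (half_pos hη)
    have hcont : Continuous fun y : C => p (y - x) :=
      hp.comp (continuous_subtype_val.sub continuous_const)
    have hnear : ∀ᶠ y : C in 𝓝 x, p (y - x) < η / 2 :=
      hcont.continuousAt.eventually (gt_mem_nhds (by simpa using half_pos hη))
    refine ⟨N + 1, ?_⟩
    filter_upwards [hnear] with y hy
    refine ⟨by positivity, fun e he => ?_⟩
    have he' : N ≤ e := by
      have : (N : ℝ) ≤ e := by linarith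
      exact_mod_cast this
    have h1 := hN e he'
    rw [Real.dist_eq, sub_zero] at h1
    have h2 : |g e (y - x)| ≤ p (y - x) := hg e _
    rw [map_sub] at h2
    have h3 := abs_add_le (g e y - g e x) (g e x)
    rw [sub_add_cancel] at h3
    linarith

/-- After passing to a subsequence, a pointwise null sequence of functionals on a cone
is almost triangular. -/
lemma HasNullSeq.exists_almost_triangular {C : Set L} (hC : IsConvexCone C) {p : Seminorm ℝ L}
    (h : HasNullSeq p {x | x ∈ C ∧ p x ≤ 1}) :
    ∃ (g : ℕ → L →ₗ[ℝ] ℝ) (c : ℕ → L) (δ : ℝ), 0 < δ ∧ δ ≤ 1 ∧ (∀ k x, |g k x| ≤ p x) ∧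
      (∀ k, c k ∈ C) ∧ (∀ k, p (c k) ≤ 1) ∧
      (∀ x ∈ C, Tendsto (fun k => g k x) atTop (𝓝 0)) ∧ (∀ k, δ ≤ g k (c k)) ∧
      ∀ j k, j < k → |g k (c j)| ≤ δ ^ 3 / 128 := by
  obtain ⟨g, c, δ, hδ, hg, hcK, hnull, hdiag⟩ := h
  have hnullC : ∀ x ∈ C, Tendsto (fun k => g k x) atTop (𝓝 0) := by
    intro x hx
    have ht : 0 < p x + 1 := by have := apply_nonneg p x; linarith
    have hxK : (p x + 1)⁻¹ • x ∈ {x | x ∈ C ∧ p x ≤ 1} := by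
      refine ⟨hC.smul_mem (inv_nonneg.2 ht.le) hx, ?_⟩
      rw [map_smul_eq_mul, Real.norm_of_nonneg (inv_nonneg.2 ht.le), inv_mul_le_one₀ ht]
      linarith
    have := (hnull _ hxK).const_mul (p x + 1)
    simpa only [map_smul, smul_eq_mul, mul_inv_cancel_left₀ ht.ne', mul_zero] using this
  have hη : 0 < δ ^ 3 / 128 := by positivity
  obtain ⟨τ, -, hτ⟩ := exists_seq_of_forall_finset_exists (fun _ : ℕ => True)
    (fun j k => j < k ∧ |g k (c j)| ≤ δ ^ 3 / 128) (by
      intro s _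
      have : ∀ᶠ k in atTop, ∀ j ∈ s, j < k ∧ |g k (c j)| ≤ δ ^ 3 / 128 := by
        rw [Filter.eventually_all_finset]
        intro j _
        refine (eventually_gt_atTop j).and ?_
        have := (hnull _ (hcK j)).abs
        rw [abs_zero] at this
        exact this.eventually (ge_mem_nhds hη)
      obtain ⟨k, hk⟩ := this.exists
      exact ⟨k, trivial, hk⟩)
  have hmono : StrictMono τ := fun j k hjk => (hτ j k hjk).1
  refine ⟨fun k => g (τ k), fun k => c (τ k), δ, hδ, ?_, fun k => hg _, fun k => (hcK _).1,
    fun k => (hcK _).2, fun x hx => (hnullC x hx).comp hmono.tendsto_atTop, fun k => hdiag _,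
    fun j k hjk => (hτ j k hjk).2⟩
  exact (hdiag 0).trans ((le_abs_self _).trans ((hg 0 _).trans (hcK 0).2))

/-- A sequence of functionals that is null pointwise on the cone `C` but not uniformly on its
unit ball yields continuous markers `M n : C → C` of size at most `1` such that the maps
`x ↦ x + M n x` have uniformly separated images. The marker `M n x` lies on a piecewise
linear path through the points `c (Nat.pair n k)`, at time equal to the level of `x`. -/
lemma HasNullSeq.exists_markers [TopologicalSpace L] [IsTopologicalAddGroup L]
    [ContinuousSMul ℝ L] {C : Set L} [NormalSpace C] [ParacompactSpace C] (hC : IsConvexCone C)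
    {p : Seminorm ℝ L} (hp : Continuous p) (h : HasNullSeq p {x | x ∈ C ∧ p x ≤ 1}) :
    ∃ M : ℕ → C(C, L), (∀ n x, M n x ∈ C) ∧ (∀ n x, p (M n x) ≤ 1) ∧
      ∃ ρ > 0, ∀ n m, n ≠ m → ∀ x y : C, ρ ≤ p ((x + M n x) - (y + M m y)) := by
  obtain ⟨g, c, δ, hδ, hδ1, hg, hcC, hcp, hnull, hdiag, hlow⟩ := h.exists_almost_triangular hC
  have hη : 0 < δ ^ 3 / 128 := by positivity
  obtain ⟨t, ht⟩ := exists_continuous_level hp hg hnull hη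
  choose γ hγ using fun n : ℕ => exists_piecewise_linear fun k => c (Nat.pair n k)
  have hform : ∀ x : C, ∃ (k : ℕ) (s : ℝ), 0 ≤ s ∧ s ≤ 1 ∧
      (∀ n, γ n (t x) = (1 - s) • c (Nat.pair n k) + s • c (Nat.pair n (k + 1))) ∧
      ∀ n e, Nat.pair n k ≤ e → |g e x| ≤ δ ^ 3 / 128 := by
    intro x
    have h1 := Nat.floor_le (ht x).1
    have h2 := Nat.lt_floor_add_one (t x)
    refine ⟨⌊t x⌋₊, t x - ⌊t x⌋₊, by linarith, by linarith, fun n => ?_, fun n e he => ?_⟩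
    · rw [← hγ n _ _ (by linarith) (by linarith), add_sub_cancel]
    · refine (ht x).2 e ?_
      have : (⌊t x⌋₊ : ℝ) ≤ e := by exact_mod_cast (Nat.right_le_pair _ _).trans he
      linarith
  choose k s hs0 hs1 hks hlev using hform
  refine ⟨fun n => (γ n).comp t, fun n x => ?_, fun n x => ?_, δ ^ 3 / 128, hη,
    fun n m hnm x y => ?_⟩
  · rw [ContinuousMap.comp_apply, hks x n]
    exact hC.1 (hcC _) (hcC _) (by linarith [hs1 x]) (hs0 x) (by ring)
  · rw [ContinuousMap.comp_apply, hks x n]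
    have := p.convexOn.2 (mem_univ (c (Nat.pair n (k x)))) (mem_univ (c (Nat.pair n (k x + 1))))
      (by linarith [hs1 x] : 0 ≤ 1 - s x) (hs0 x) (by ring)
    refine this.trans ?_
    rw [smul_eq_mul, smul_eq_mul]
    nlinarith [hcp (Nat.pair n (k x)), hcp (Nat.pair n (k x + 1)), hs0 x, hs1 x]
  · rw [ContinuousMap.comp_apply, ContinuousMap.comp_apply, hks x n, hks y m]
    have hne : ∀ i j, Nat.pair n i ≠ Nat.pair m j := fun i j hij =>
      hnm (Nat.pair_eq_pair.1 hij).1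
    have hlt : ∀ n i, Nat.pair n i < Nat.pair n (i + 1) := fun n i =>
      Nat.pair_lt_pair_right n (Nat.lt_succ_self i)
    rcases lt_or_gt_of_ne (hne (k x + 1) (k y + 1)) with hlt' | hgt'
    · exact le_seminorm_sub_of_lt hδ hδ1 rfl hg hcp hdiag hlow (hlt _ _) hlt' (hlt _ _)
        (hne _ _) (hne _ _) (hs0 x) (hs1 x) (hs0 y) (hs1 y) (hlev x n) (hlev y m)
    · rw [map_sub_rev]
      exact le_seminorm_sub_of_lt hδ hδ1 rfl hg hcp hdiag hlow (hlt _ _) hgt' (hlt _ _)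
        (hne _ _).symm (hne _ _).symm (hs0 y) (hs1 y) (hs0 x) (hs1 x) (hlev y m) (hlev x n)

end Markers

/-! ### The separated approximation property -/

theorem mainTheorem4 {L : Type*} [AddCommGroup L] [Module ℝ L] [MetricSpace L]
    [IsTopologicalAddGroup L] [ContinuousSMul ℝ L] [LocallyConvexSpace ℝ L] [CompleteSpace L]
    (hinv : ∀ x y z : L, dist (x + z) (y + z) = dist x y)
    (C : Set L) (hC : IsConvexCone C) (hsep : ¬ TopologicalSpace.SeparableSpace C) :
    HasSAP C := by
  intro ε hε
  have hdist : ∀ x y : L, dist x y = dist (x - y) 0 := fun x y => by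
    rw [← hinv (x - y) 0 y, sub_add_cancel, zero_add]
  obtain ⟨p₀, hp₀, hp₀ε⟩ := exists_continuous_seminorm_subset (Metric.ball_mem_nhds (0 : L) hε)
  obtain ⟨p, hp, hp₀p, δ, hδ, hfin⟩ := exists_seminorm_forall_finite hC hsep hp₀
  obtain ⟨M, hMC, hMp, ρ, hρ, hM⟩ := (hasNullSeq_of_forall_finite hδ hfin).exists_markers hC hp
  refine ⟨fun n => ⟨fun x => ⟨x + M n x, hC.add_mem x.2 (hMC n x)⟩, by fun_prop⟩,
    fun n => ?_, ?_⟩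
  · refine ⟨⟨⟨fun q => ⟨q.2 + (1 - (q.1 : ℝ)) • M n q.2,
      hC.add_mem q.2.2 (hC.smul_mem (by linarith [q.1.2.2]) (hMC n q.2))⟩, by fun_prop⟩,
      fun x => by ext; simp, fun x => by ext; simp⟩, fun x => ?_⟩
    refine Metric.diam_le_of_forall_dist_le hε.le ?_
    rintro _ ⟨s, rfl⟩ _ ⟨t, rfl⟩
    change dist ((x : L) + (1 - (s : ℝ)) • M n x) (x + (1 - (t : ℝ)) • M n x) ≤ ε
    have h1 : ((x : L) + (1 - (s : ℝ)) • M n x) - (x + (1 - (t : ℝ)) • M n x) =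
        ((t : ℝ) - s) • M n x := by
      rw [add_sub_add_left_eq_sub, ← sub_smul]
      congr 1
      ring
    rw [hdist, h1]
    refine (Metric.mem_ball.1 (hp₀ε (?_ : p₀ _ ≤ 1))).le
    rw [map_smul_eq_mul, Real.norm_eq_abs]
    refine mul_le_one₀ ?_ (apply_nonneg _ _) ((hp₀p _).trans (hMp n x))
    rw [abs_le]
    constructor <;> linarith [s.2.1, s.2.2, t.2.1, t.2.2]
  · have hnhds : {v : L | p v < ρ} ∈ 𝓝 (0 : L) :=
      hp.continuousAt.eventually (gt_mem_nhds (by simpa using hρ))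
    obtain ⟨r, hr, hrsub⟩ := Metric.mem_nhds_iff.1 hnhds
    refine lt_of_lt_of_le (ENNReal.ofReal_pos.2 hr)
      (le_iInf fun n => le_iInf fun m => le_iInf fun hnm => ?_)
    refine le_iInf fun a => le_iInf fun ha => le_iInf fun b => le_iInf fun hb => ?_
    obtain ⟨x, rfl⟩ := ha
    obtain ⟨y, rfl⟩ := hb
    rw [edist_dist]
    refine ENNReal.ofReal_le_ofReal ?_
    change r ≤ dist ((x : L) + M n x) (y + M m y)
    by_contra! hlt
    rw [hdist] at hlt
    exact absurd (hM n m hnm x y) (not_le.2 (hrsub (Metric.mem_ball.2 hlt)))
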